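/- Let $(F_n)_{n\ge 0}$ be a sequence of finite-dimensional $\mathrm{C}^*$-algebras with completely positive contractive (c.p.c.) maps $\rho_{n+1,n}\colon F_n\to F_{n+1}$. Put $\rho_{n,n}=\mathrm{id}_{F_n}$ and $\rho_{m,n}=\rho_{m,m-1}\circ\dots\circ\rho_{n+1,n}$ for $m>n$. Let $F_\infty=\prod_n F_n/\bigoplus_n F_n$ be the $\mathrm{C}^*$-algebra of norm-bounded sequences modulo null sequences, let $\rho_n\colon F_n\to F_\infty$ be given by $\rho_n(x)=[(\rho_{m,n}(x))_{m>n}]$, and let $X=\overline{\bigcup_n\rho_n(F_n)}\subset F_\infty$. Assume that $(F_n,\rho_{n+1,n})_n$ is a $\mathrm{CPC}^*$-system, i.e. for all $k\ge 0$, $x,y\in F_k$ and $\varepsilon>0$ there is $M>k$ such that for all $m,n,l$ with $m>n>M$ and $m>l>M$, $$\|\rho_{m,l}(1_{F_l})\,\rho_{m,n}\big(\rho_{n,k}(x)\rho_{n,k}(y)\big)-\rho_{m,k}(x)\rho_{m,k}(y)\|<\varepsilon .$$ Let $\mathrm{C}^*_\bullet(X)$ be the $\mathrm{CPC}^*$-limit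 of the system: the space $X$ with the linear structure, norm and involution of $F_\infty$ and with the unique continuous bilinear product satisfying $$\rho_k(x)\bullet\rho_k(y)=\lim_n\rho_n\big(\rho_{n,k}(x)\rho_{n,k}(y)\big)\qquad(k\ge 0,\ x,y\in F_k);$$ with these operations $\mathrm{C}^*_\bullet(X)$ is a $\mathrm{C}^*$-algebra. Then $(\rho_n(1_{F_n}))_n$ is an increasing approximate identity for $\mathrm{C}^*_\bullet(X)$: with respect to the order of the $\mathrm{C}^*$-algebra $\mathrm{C}^*_\bullet(X)$, it is an increasing sequence of positive elements of norm at most $1$, and $\rho_n(1_{F_n})\bullet a\to a$ and $a\bullet\rho_n(1_{F_n})\to a$ in norm for every $a\in X$. -/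

import Mathlib

open Filter Topology
open scoped ENNReal CStarAlgebra

noncomputable section

/-! ### The sequence algebra `∏ F n / ⨁ F n` -/

section SequenceAlgebra

variable (F : ℕ → Type*) [∀ n, NonUnitalCStarAlgebra (F n)]

/-- The null sequences, as a subspace of the C⋆-algebra `lp F ∞ = ∏ F n` of bounded sequences. -/
def nullSequences : Submodule ℂ (lp F ∞) where
  carrier := {x | Tendsto (fun n => ‖x n‖) atTop (𝓝 0)}
  zero_mem' := by simp
  add_mem' := by
    intro a b ha hb
    have h := Tendsto.add ha hb
    rw [add_zero] at h
    exact squeeze_zero (fun n => norm_nonneg _) (fun n => norm_add_le (a n) (b n)) h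
  smul_mem' := by
    intro c x hx
    have h := Tendsto.const_mul ‖c‖ hx
    rw [mul_zero] at h
    exact squeeze_zero (fun n => norm_nonneg _) (fun n => (norm_smul c (x n)).le) h

variable {F}

theorem mem_nullSequences {x : lp F ∞} :
    x ∈ nullSequences F ↔ Tendsto (fun n => ‖x n‖) atTop (𝓝 0) := Iff.rfl

theorem mem_nullSequences' {x : lp F ∞} :
    x ∈ nullSequences F ↔ ∀ ε > 0, ∀ᶠ n in atTop, ‖x n‖ < ε := by
  rw [mem_nullSequences, NormedAddGroup.tendsto_nhds_zero]
  simp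

instance isClosed_nullSequences : IsClosed (nullSequences F : Set (lp F ∞)) := by
  refine isClosed_of_closure_subset fun x hx => ?_
  rw [SetLike.mem_coe, mem_nullSequences']
  intro ε hε
  obtain ⟨y, hy, hxy⟩ := Metric.mem_closure_iff.1 hx (ε / 2) (half_pos hε)
  filter_upwards [mem_nullSequences'.1 hy (ε / 2) (half_pos hε)] with n hn
  have h1 : ‖(x - y) n‖ ≤ ‖x - y‖ := lp.norm_apply_le_norm ENNReal.top_ne_zero _ _
  rw [dist_eq_norm] at hxy
  have h2 : ‖x n‖ ≤ ‖x n - y n‖ + ‖y n‖ := by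
    simpa using norm_add_le (x n - y n) (y n)
  have h3 : (x - y) n = x n - y n := rfl
  rw [h3] at h1
  linarith

variable (F) in
/-- The quotient of bounded sequences by null sequences, with the quotient norm. -/
def SeqAlg : Type _ := lp F ∞ ⧸ nullSequences F

namespace SeqAlg

instance : NormedAddCommGroup (SeqAlg F) :=
  inferInstanceAs (NormedAddCommGroup (lp F ∞ ⧸ nullSequences F))

instance : NormedSpace ℂ (SeqAlg F) :=
  inferInstanceAs (NormedSpace ℂ (lp F ∞ ⧸ nullSequences F))

instance : CompleteSpace (SeqAlg F) :=
  inferInstanceAs (CompleteSpace (lp F ∞ ⧸ nullSequences F))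

/-- The class `[(x n)]` of a bounded sequence. -/
def mk : lp F ∞ →ₗ[ℂ] SeqAlg F := (nullSequences F).mkQ

theorem mk_surjective : Function.Surjective (mk : lp F ∞ → SeqAlg F) :=
  Submodule.mkQ_surjective _

/-- A bounded sequence representing `z ∈ F_∞`. -/
def lift (z : SeqAlg F) : lp F ∞ := (mk_surjective z).choose

theorem mk_lift (z : SeqAlg F) : mk (lift z) = z := (mk_surjective z).choose_spec

theorem mk_eq_mk {x y : lp F ∞} : mk x = mk y ↔ x - y ∈ nullSequences F :=
  Submodule.Quotient.eq _

theorem norm_mk_le (x : lp F ∞) : ‖mk x‖ ≤ ‖x‖ :=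
  Submodule.Quotient.norm_mk_le (nullSequences F) x

theorem eventually_norm_lt (x : lp F ∞) {c : ℝ} (hc : ‖mk x‖ < c) :
    ∀ᶠ n in atTop, ‖x n‖ < c := by
  obtain ⟨y, hy, hyn⟩ := Submodule.Quotient.norm_mk_lt (S := nullSequences F) (mk x)
    (ε := (c - ‖mk x‖) / 2) (by linarith)
  have hyx : x - y ∈ nullSequences F := mk_eq_mk.1 (Eq.symm hy)
  filter_upwards [mem_nullSequences'.1 hyx ((c - ‖mk x‖) / 2) (by linarith)] with n hn
  have h1 : ‖y n‖ ≤ ‖y‖ := lp.norm_apply_le_norm ENNReal.top_ne_zero _ _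
  have h2 : ‖x n‖ ≤ ‖x n - y n‖ + ‖y n‖ := by
    simpa using norm_add_le (x n - y n) (y n)
  have h3 : (x - y) n = x n - y n := rfl
  rw [h3] at hn
  have h4 : ‖y‖ < ‖mk x‖ + (c - ‖mk x‖) / 2 := hyn
  linarith

theorem norm_mk_le_of_eventually {x : lp F ∞} {c : ℝ} (hc : 0 ≤ c)
    (h : ∀ᶠ n in atTop, ‖x n‖ ≤ c) : ‖mk x‖ ≤ c := by
  classical
  let f : ∀ n, F n := fun n => if ‖x n‖ ≤ c then x n else 0
  have hf : ∀ n, ‖f n‖ ≤ c := by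
    intro n
    by_cases hn : ‖x n‖ ≤ c <;> simp [f, hn, hc]
  let y : lp F ∞ := ⟨f, memℓp_infty ⟨c, by rintro _ ⟨n, rfl⟩; exact hf n⟩⟩
  have hxy : mk x = mk y := by
    rw [mk_eq_mk, mem_nullSequences]
    refine tendsto_const_nhds.congr' ?_
    filter_upwards [h] with n hn
    have : (x - y) n = x n - f n := rfl
    simp [this, f, hn]
  rw [hxy]
  exact (norm_mk_le y).trans (lp.norm_le_of_forall_le hc hf)

theorem mul_sub_mul_mem {a a' b b' : lp F ∞} (ha : a - a' ∈ nullSequences F)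
    (hb : b - b' ∈ nullSequences F) : a * b - a' * b' ∈ nullSequences F := by
  rw [mem_nullSequences] at *
  have h : Tendsto (fun n => ‖(a - a') n‖ * ‖b‖ + ‖a'‖ * ‖(b - b') n‖) atTop (𝓝 0) := by
    simpa using (ha.mul_const ‖b‖).add (hb.const_mul ‖a'‖)
  refine squeeze_zero (fun n => norm_nonneg _) (fun n => ?_) h
  have e : (a * b - a' * b') n = (a - a') n * b n + a' n * (b - b') n := by
    change a n * b n - a' n * b' n = (a n - a' n) * b n + a' n * (b n - b' n)
    rw [sub_mul, mul_sub]; abel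
  have h1 : ‖b n‖ ≤ ‖b‖ := lp.norm_apply_le_norm ENNReal.top_ne_zero _ _
  have h2 : ‖a' n‖ ≤ ‖a'‖ := lp.norm_apply_le_norm ENNReal.top_ne_zero _ _
  rw [e]
  refine (norm_add_le _ _).trans (add_le_add ?_ ?_)
  · exact (norm_mul_le _ _).trans (by gcongr)
  · exact (norm_mul_le _ _).trans (by gcongr)

theorem star_sub_star_mem {a a' : lp F ∞} (ha : a - a' ∈ nullSequences F) :
    star a - star a' ∈ nullSequences F := by
  rw [mem_nullSequences] at *
  refine ha.congr fun n => ?_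
  have e : (star a - star a') n = star ((a - a') n) := (star_sub (a n) (a' n)).symm
  rw [e, norm_star]

/-- Multiplication is induced by the termwise product. -/
instance : Mul (SeqAlg F) :=
  ⟨Quotient.map₂ (fun a b : lp F ∞ => a * b) fun _ _ ha _ _ hb =>
    (Submodule.quotientRel_def _).2 (mul_sub_mul_mem ((Submodule.quotientRel_def _).1 ha)
      ((Submodule.quotientRel_def _).1 hb))⟩

/-- The involution is induced by the termwise involution. -/
instance : Star (SeqAlg F) :=
  ⟨Quotient.map (fun a : lp F ∞ => star a) fun _ _ ha =>
    (Submodule.quotientRel_def _).2 (star_sub_star_mem ((Submodule.quotientRel_def _).1 ha))⟩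

theorem mk_mul (a b : lp F ∞) : mk (a * b) = mk a * mk b := rfl

theorem mk_star (a : lp F ∞) : mk (star a) = star (mk a) := rfl

instance : NonUnitalRing (SeqAlg F) :=
  mk_surjective.nonUnitalRing mk (map_zero _) (map_add _) mk_mul (map_neg _) (map_sub _)
    (fun _ _ => rfl) (fun _ _ => rfl)

instance : NonUnitalNormedRing (SeqAlg F) where
  dist_eq := NormedAddCommGroup.dist_eq
  norm_mul_le x y := by
    obtain ⟨a, rfl⟩ := mk_surjective x
    obtain ⟨b, rfl⟩ := mk_surjective y
    have key : ∀ c > ‖mk a‖, ∀ d > ‖mk b‖, ‖mk a * mk b‖ ≤ c * d := by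
      intro c hc d hd
      have hc0 := (norm_nonneg _).trans hc.le
      have hd0 := (norm_nonneg _).trans hd.le
      refine norm_mk_le_of_eventually (x := a * b) (mul_nonneg hc0 hd0) ?_
      filter_upwards [eventually_norm_lt a hc, eventually_norm_lt b hd] with n h1 h2
      exact (norm_mul_le (a n) (b n)).trans (by gcongr)
    have h1 : ∀ d > ‖mk b‖, ‖mk a * mk b‖ ≤ ‖mk a‖ * d := by
      intro d hd
      have : Tendsto (fun c : ℝ => c * d) (𝓝[>] ‖mk a‖) (𝓝 (‖mk a‖ * d)) :=
        (tendsto_nhdsWithin_of_tendsto_nhds tendsto_id).mul_const d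
      refine ge_of_tendsto this ?_
      filter_upwards [self_mem_nhdsWithin] with c hc using key c hc d hd
    have : Tendsto (fun d : ℝ => ‖mk a‖ * d) (𝓝[>] ‖mk b‖) (𝓝 (‖mk a‖ * ‖mk b‖)) :=
      (tendsto_nhdsWithin_of_tendsto_nhds tendsto_id).const_mul _
    refine ge_of_tendsto this ?_
    filter_upwards [self_mem_nhdsWithin] with d hd using h1 d hd

instance : StarRing (SeqAlg F) where
  star_involutive x := by
    obtain ⟨a, rfl⟩ := mk_surjective x
    rw [← mk_star, ← mk_star, star_star]
  star_mul x y := by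
    obtain ⟨a, rfl⟩ := mk_surjective x
    obtain ⟨b, rfl⟩ := mk_surjective y
    rw [← mk_mul, ← mk_star, star_mul, mk_mul, mk_star, mk_star]
  star_add x y := by
    obtain ⟨a, rfl⟩ := mk_surjective x
    obtain ⟨b, rfl⟩ := mk_surjective y
    rw [← map_add, ← mk_star, star_add, map_add, mk_star, mk_star]

instance : CStarRing (SeqAlg F) where
  norm_mul_self_le x := by
    obtain ⟨a, rfl⟩ := mk_surjective x
    have key : ∀ c > ‖star (mk a) * mk a‖, ‖mk a‖ * ‖mk a‖ ≤ c := by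
      intro c hc
      have hc0 : 0 ≤ c := (norm_nonneg _).trans hc.le
      have h : ‖mk a‖ ≤ √c := by
        refine norm_mk_le_of_eventually (Real.sqrt_nonneg c) ?_
        filter_upwards [eventually_norm_lt (star a * a) hc] with n hn
        have h1 : (star a * a) n = star (a n) * a n := rfl
        rw [h1, CStarRing.norm_star_mul_self, ← sq] at hn
        exact Real.le_sqrt_of_sq_le hn.le
      calc ‖mk a‖ * ‖mk a‖ ≤ √c * √c := by gcongr
        _ = c := Real.mul_self_sqrt hc0
    exact le_of_forall_gt_imp_ge_of_dense key

instance : NonUnitalCStarAlgebra (SeqAlg F) where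
  smul_assoc c x y := by
    obtain ⟨a, rfl⟩ := mk_surjective x
    obtain ⟨b, rfl⟩ := mk_surjective y
    rw [smul_eq_mul, ← map_smul, ← mk_mul, smul_mul_assoc, map_smul]; rfl
  smul_comm c x y := by
    obtain ⟨a, rfl⟩ := mk_surjective x
    obtain ⟨b, rfl⟩ := mk_surjective y
    rw [smul_eq_mul, smul_eq_mul, ← map_smul, ← mk_mul, ← mk_mul, mul_smul_comm, map_smul]
  star_smul c x := by
    obtain ⟨a, rfl⟩ := mk_surjective x
    rw [← map_smul, ← mk_star, star_smul, map_smul, mk_star]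

/-- The sequence algebra carries the order of a C⋆-algebra: `0 ≤ x` iff `x = star y * y`
for some `y`. -/
instance : PartialOrder (SeqAlg F) := CStarAlgebra.spectralOrder _

instance : StarOrderedRing (SeqAlg F) := CStarAlgebra.spectralOrderedRing _

theorem mk_nonneg [∀ n, PartialOrder (F n)] [∀ n, StarOrderedRing (F n)] {x : lp F ∞}
    (h : ∀ᶠ n in atTop, 0 ≤ x n) : 0 ≤ mk x := by
  classical
  have h1 : ∀ n, ∃ b : F n, ‖b‖ ≤ √‖x‖ ∧ (0 ≤ x n → x n = star b * b) := by
    intro n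
    by_cases hn : 0 ≤ x n
    · obtain ⟨b, hb⟩ := CStarAlgebra.nonneg_iff_eq_star_mul_self.1 hn
      refine ⟨b, Real.le_sqrt_of_sq_le ?_, fun _ => hb⟩
      rw [sq, ← CStarRing.norm_star_mul_self, ← hb]
      exact lp.norm_apply_le_norm ENNReal.top_ne_zero _ _
    · exact ⟨0, by simp, fun h => absurd h hn⟩
  choose b hb hb' using h1
  let y : lp F ∞ := ⟨b, memℓp_infty ⟨√‖x‖, by rintro _ ⟨n, rfl⟩; exact hb n⟩⟩
  have hxy : mk x = star (mk y) * mk y := by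
    rw [← mk_star, ← mk_mul, mk_eq_mk, mem_nullSequences]
    refine tendsto_const_nhds.congr' ?_
    filter_upwards [h] with n hn
    have e1 : (x - star y * y) n = x n - star (b n) * b n := rfl
    rw [e1, ← hb' n hn, sub_self, norm_zero]
  rw [hxy]
  exact star_mul_self_nonneg _

end SeqAlg

end SequenceAlgebra

/-! ### Systems of completely positive contractive maps and their limits -/

/-- A sequence of completely positive contractive maps `F n → F (n + 1)` between unital
C⋆-algebras. (Completely positive contractions between C⋆-algebras are automatically completely
contractive.) -/
structure CPCSystem (F : ℕ → Type*) [∀ n, CStarAlgebra (F n)] [∀ n, PartialOrder (F n)]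
    [∀ n, StarOrderedRing (F n)] where
  /-- The connecting map `ρ_{n+1,n}`. -/
  map : ∀ n, F n →CP F (n + 1)
  norm_map_le : ∀ n x, ‖map n x‖ ≤ ‖x‖

namespace CPCSystem

variable {F : ℕ → Type*} [∀ n, CStarAlgebra (F n)] [∀ n, PartialOrder (F n)]
  [∀ n, StarOrderedRing (F n)] (S : CPCSystem F)

/-- The composed connecting map `ρ_{m,n} : F n → F m`, which is the identity for `m = n` and
`ρ_{m,m-1} ∘ ⋯ ∘ ρ_{n+1,n}` for `n < m`; it is set to be `0` for `m < n`. -/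
def ρ (m n : ℕ) : F n →ₗ[ℂ] F m :=
  if h : n ≤ m then
    Nat.leRec (motive := fun m _ => F n →ₗ[ℂ] F m) LinearMap.id
      (fun m _ f => (S.map m).toLinearMap ∘ₗ f) h
  else 0

theorem ρ_self (n : ℕ) (x : F n) : S.ρ n n x = x := by simp [ρ]

theorem ρ_succ {m n : ℕ} (h : n ≤ m) (x : F n) : S.ρ (m + 1) n x = S.map m (S.ρ m n x) := by
  have h' : n ≤ m + 1 := by omega
  rw [ρ, ρ, dif_pos h, dif_pos h', Nat.leRec_succ _ _ h]
  rfl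

theorem ρ_of_lt {m n : ℕ} (h : m < n) : S.ρ m n = 0 := by
  rw [ρ, dif_neg (by omega)]

theorem ρ_comp {m n k : ℕ} (hkn : k ≤ n) (hnm : n ≤ m) (x : F k) :
    S.ρ m n (S.ρ n k x) = S.ρ m k x := by
  induction m, hnm using Nat.le_induction with
  | base => rw [ρ_self]
  | succ m hnm ih => rw [ρ_succ S hnm, ρ_succ S (hkn.trans hnm), ih]

theorem norm_ρ_le (m n : ℕ) (x : F n) : ‖S.ρ m n x‖ ≤ ‖x‖ := by
  rcases lt_or_ge m n with h | h
  · rw [S.ρ_of_lt h]; simp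
  induction m, h using Nat.le_induction with
  | base => rw [ρ_self]
  | succ m hnm ih => rw [ρ_succ S hnm]; exact (S.norm_map_le _ _).trans ih

theorem ρ_nonneg (m n : ℕ) {x : F n} (hx : 0 ≤ x) : 0 ≤ S.ρ m n x := by
  rcases lt_or_ge m n with h | h
  · rw [S.ρ_of_lt h]; simp
  induction m, h using Nat.le_induction with
  | base => rwa [ρ_self]
  | succ m hnm ih => rw [ρ_succ S hnm]; exact map_nonneg _ ih

theorem ρ_mono (m n : ℕ) {x y : F n} (hx : x ≤ y) : S.ρ m n x ≤ S.ρ m n y := by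
  have := S.ρ_nonneg m n (sub_nonneg.2 hx)
  rwa [map_sub, sub_nonneg] at this

theorem ρ_star (m n : ℕ) (x : F n) : S.ρ m n (star x) = star (S.ρ m n x) := by
  have key : ∀ y : F n, 0 ≤ y → IsSelfAdjoint (S.ρ m n y) := fun y hy =>
    IsSelfAdjoint.of_nonneg (S.ρ_nonneg m n hy)
  obtain ⟨y, hy, -, hxy⟩ := CStarAlgebra.exists_sum_four_nonneg x
  rw [hxy]
  simp only [map_sum, star_sum, star_smul, map_smul]
  refine Finset.sum_congr rfl fun i _ => ?_
  rw [(key _ (hy i)).star_eq, (IsSelfAdjoint.of_nonneg (hy i)).star_eq]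

/-- The bounded sequence `(ρ_{m,n}(x))_m`. -/
def boundedSeq (n : ℕ) (x : F n) : lp F ∞ :=
  ⟨fun m => S.ρ m n x, memℓp_infty ⟨‖x‖, by rintro _ ⟨m, rfl⟩; exact S.norm_ρ_le m n x⟩⟩

/-- The induced map `ρ_n : F n → F_∞`, `ρ_n(x) = [(ρ_{m,n}(x))_{m > n}]`. -/
def toSeqAlg (n : ℕ) : F n →ₗ[ℂ] SeqAlg F where
  toFun x := SeqAlg.mk (S.boundedSeq n x)
  map_add' x y := by
    rw [← map_add]; congr 1; ext m; exact map_add (S.ρ m n) x y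
  map_smul' c x := by
    rw [RingHom.id_apply, ← map_smul]; congr 1; ext m; exact map_smul (S.ρ m n) c x

theorem toSeqAlg_apply (n : ℕ) (x : F n) : S.toSeqAlg n x = SeqAlg.mk (S.boundedSeq n x) := rfl

theorem norm_toSeqAlg_le (n : ℕ) (x : F n) : ‖S.toSeqAlg n x‖ ≤ ‖x‖ :=
  SeqAlg.norm_mk_le_of_eventually (norm_nonneg _) (.of_forall fun m => S.norm_ρ_le m n x)

theorem toSeqAlg_nonneg (n : ℕ) {x : F n} (hx : 0 ≤ x) : 0 ≤ S.toSeqAlg n x :=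
  SeqAlg.mk_nonneg (.of_forall fun m => S.ρ_nonneg m n hx)

theorem toSeqAlg_star (n : ℕ) (x : F n) : S.toSeqAlg n (star x) = star (S.toSeqAlg n x) := by
  rw [toSeqAlg_apply, toSeqAlg_apply, ← SeqAlg.mk_star]
  congr 1; ext m; exact S.ρ_star m n x

theorem toSeqAlg_ρ {n k : ℕ} (hkn : k ≤ n) (x : F k) :
    S.toSeqAlg n (S.ρ n k x) = S.toSeqAlg k x := by
  rw [toSeqAlg_apply, toSeqAlg_apply, SeqAlg.mk_eq_mk, mem_nullSequences]
  refine tendsto_const_nhds.congr' ?_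
  filter_upwards [eventually_ge_atTop n] with m hm
  have e : (S.boundedSeq n (S.ρ n k x) - S.boundedSeq k x) m =
    S.ρ m n (S.ρ n k x) - S.ρ m k x := rfl
  rw [e, S.ρ_comp hkn hm, sub_self, norm_zero]

/-- The union of the increasing sequence of subspaces `ρ_n(F n)` of `F_∞`. -/
def unionRange : Submodule ℂ (SeqAlg F) where
  carrier := ⋃ n, Set.range (S.toSeqAlg n)
  zero_mem' := Set.mem_iUnion.2 ⟨0, 0, map_zero _⟩
  add_mem' := by
    intro a b ha hb
    obtain ⟨n, x, rfl⟩ := Set.mem_iUnion.1 ha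
    obtain ⟨m, y, rfl⟩ := Set.mem_iUnion.1 hb
    refine Set.mem_iUnion.2 ⟨max n m, S.ρ _ n x + S.ρ _ m y, ?_⟩
    rw [map_add, S.toSeqAlg_ρ (le_max_left n m), S.toSeqAlg_ρ (le_max_right n m)]
  smul_mem' := by
    intro c a ha
    obtain ⟨n, x, rfl⟩ := Set.mem_iUnion.1 ha
    exact Set.mem_iUnion.2 ⟨n, c • x, map_smul _ c x⟩

/-- The limit of the system: the closure of `⋃ n, ρ_n(F n)` in `F_∞`. -/
def limit : Submodule ℂ (SeqAlg F) := S.unionRange.topologicalClosure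

theorem isClosed_limit : IsClosed (S.limit : Set (SeqAlg F)) :=
  Submodule.isClosed_topologicalClosure _

theorem toSeqAlg_mem_limit (n : ℕ) (x : F n) : S.toSeqAlg n x ∈ S.limit :=
  Submodule.le_topologicalClosure _ (Set.mem_iUnion.2 ⟨n, x, rfl⟩)

theorem exists_norm_sub_lt {z : SeqAlg F} (hz : z ∈ S.limit) {ε : ℝ} (hε : 0 < ε) :
    ∃ n x, ‖z - S.toSeqAlg n x‖ < ε := by
  obtain ⟨w, hw, hzw⟩ := Metric.mem_closure_iff.1 hz ε hε
  obtain ⟨n, x, rfl⟩ := Set.mem_iUnion.1 hw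
  exact ⟨n, x, by rwa [dist_eq_norm] at hzw⟩

/-- A closed property that holds on all `ρ_n(F n)` holds on the limit. -/
theorem limit_induction {P : SeqAlg F → Prop} (hP : IsClosed {z | P z})
    (h : ∀ n x, P (S.toSeqAlg n x)) {z : SeqAlg F} (hz : z ∈ S.limit) : P z := by
  have : closure (S.unionRange : Set (SeqAlg F)) ⊆ {z | P z} := by
    refine hP.closure_subset_iff.2 fun w hw => ?_
    obtain ⟨n, x, rfl⟩ := Set.mem_iUnion.1 hw
    exact h n x
  exact this hz

theorem star_mem_limit {z : SeqAlg F} (hz : z ∈ S.limit) : star z ∈ S.limit := by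
  refine S.limit_induction (P := fun z => star z ∈ S.limit)
    (S.isClosed_limit.preimage continuous_star) (fun n x => ?_) hz
  rw [← S.toSeqAlg_star]
  exact S.toSeqAlg_mem_limit _ _

end CPCSystem

/-! ### CPC*-systems -/

/-- A CPC*-system: a system of c.p.c. maps between finite-dimensional C⋆-algebras which is
asymptotically order zero. -/
structure CPCStarSystem (F : ℕ → Type*) [∀ n, CStarAlgebra (F n)] [∀ n, PartialOrder (F n)]
    [∀ n, StarOrderedRing (F n)] [∀ n, FiniteDimensional ℂ (F n)] extends CPCSystem F where
  asymptotically_order_zero : ∀ (k : ℕ) (x y : F k), ∀ ε > 0, ∃ M > k, ∀ m n l : ℕ,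
    M < n → M < l → n < m → l < m →
      ‖toCPCSystem.ρ m l 1 * toCPCSystem.ρ m n (toCPCSystem.ρ n k x * toCPCSystem.ρ n k y)
        - toCPCSystem.ρ m k x * toCPCSystem.ρ m k y‖ < ε

theorem CStarAlgebra.norm_one_le_one (A : Type*) [CStarAlgebra A] : ‖(1 : A)‖ ≤ 1 := by
  rcases subsingleton_or_nontrivial A with h | h
  · rw [Subsingleton.elim (1 : A) 0]; simp
  · exact CStarRing.norm_one.le

theorem CStarAlgebra.norm_le_norm_mul_of_le {A : Type*} [NonUnitalCStarAlgebra A] [PartialOrder A]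
    [StarOrderedRing A] {z e : A} (he : IsSelfAdjoint e)
    (h : star z * z ≤ (‖z‖ ^ 2) • (e * e)) : ‖z‖ ≤ ‖z * e‖ := by
  have h1 := star_right_conjugate_le_conjugate h z
  have h2 : 0 ≤ z * (star z * z) * star z :=
    star_right_conjugate_nonneg (star_mul_self_nonneg z) z
  have h3 := CStarAlgebra.norm_le_norm_of_nonneg_of_le h2 h1
  have e1 : z * (star z * z) * star z = (z * star z) * star (z * star z) := by
    simp only [star_mul, star_star, mul_assoc]
  have e2 : z * ((‖z‖ ^ 2) • (e * e)) * star z = (‖z‖ ^ 2) • ((z * e) * star (z * e)) := by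
    rw [star_mul, he.star_eq, mul_smul_comm, smul_mul_assoc]
    simp only [mul_assoc]
  rw [e1, e2, CStarRing.norm_self_mul_star, CStarRing.norm_self_mul_star, norm_smul,
    CStarRing.norm_self_mul_star, Real.norm_of_nonneg (by positivity)] at h3
  rcases (norm_nonneg z).eq_or_lt with h0 | h0
  · rw [← h0]; exact norm_nonneg _
  · have h4 : ‖z‖ ^ 2 * ‖z‖ ^ 2 ≤ ‖z‖ ^ 2 * ‖z * e‖ ^ 2 := by nlinarith
    have h5 := le_of_mul_le_mul_left h4 (by positivity)
    exact le_of_sq_le_sq h5 (norm_nonneg _)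

namespace CPCStarSystem

variable {F : ℕ → Type*} [∀ n, CStarAlgebra (F n)] [∀ n, PartialOrder (F n)]
  [∀ n, StarOrderedRing (F n)] [∀ n, FiniteDimensional ℂ (F n)] (S : CPCStarSystem F)

/-- The bounded sequence `(ρ_{m,m-1}(1))_m`. -/
def orderUnitSeq : lp F ∞ :=
  ⟨fun m => S.ρ m (m - 1) 1, memℓp_infty ⟨1, by
    rintro _ ⟨m, rfl⟩; exact (S.norm_ρ_le m (m - 1) 1).trans (CStarAlgebra.norm_one_le_one _)⟩⟩

/-- The order unit `e = [(ρ_{m,m-1}(1))_m]`. -/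
def orderUnit : SeqAlg F := SeqAlg.mk S.orderUnitSeq

theorem orderUnit_nonneg : 0 ≤ S.orderUnit :=
  SeqAlg.mk_nonneg (.of_forall fun m => S.ρ_nonneg m (m - 1) zero_le_one)

theorem norm_orderUnit_le : ‖S.orderUnit‖ ≤ 1 :=
  SeqAlg.norm_mk_le_of_eventually zero_le_one
    (.of_forall fun m => (S.norm_ρ_le m (m - 1) 1).trans (CStarAlgebra.norm_one_le_one _))

theorem tendsto_orderUnit_mul (k : ℕ) (x y : F k) :
    Tendsto (fun n => S.orderUnit * S.toSeqAlg n (S.ρ n k x * S.ρ n k y)) atTop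
      (𝓝 (S.toSeqAlg k x * S.toSeqAlg k y)) := by
  rw [Metric.tendsto_atTop']
  intro ε hε
  obtain ⟨M, -, hM⟩ := S.asymptotically_order_zero k x y (ε / 2) (half_pos hε)
  refine ⟨M, fun n hn => ?_⟩
  rw [dist_eq_norm]
  refine lt_of_le_of_lt ?_ (half_lt_self hε)
  refine SeqAlg.norm_mk_le_of_eventually (x := S.orderUnitSeq *
    S.boundedSeq n (S.ρ n k x * S.ρ n k y) - S.boundedSeq k x * S.boundedSeq k y)
    (half_pos hε).le ?_
  filter_upwards [eventually_gt_atTop (n + 1)] with m hm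
  exact (hM m n (m - 1) hn (by omega) (by omega) (by omega)).le

theorem commute_orderUnit {z : SeqAlg F} (hz : z ∈ S.limit) : Commute S.orderUnit z := by
  refine S.limit_induction (P := fun z => Commute S.orderUnit z)
    (isClosed_eq (continuous_const_mul _) (continuous_mul_const _)) (fun k x => ?_) hz
  have key : ∀ y : F k, 0 ≤ y → Commute S.orderUnit (S.toSeqAlg k y) := by
    intro y hy
    have hsa := IsSelfAdjoint.of_nonneg hy
    have hnn := S.toSeqAlg_nonneg k hy
    have he := IsSelfAdjoint.of_nonneg S.orderUnit_nonneg
    have h1 := S.tendsto_orderUnit_mul k y y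
    have h2 : Tendsto (fun n => S.toSeqAlg n (S.ρ n k y * S.ρ n k y) * S.orderUnit) atTop
        (𝓝 (S.toSeqAlg k y * S.toSeqAlg k y)) := by
      have h3 := h1.star
      rw [star_mul, (IsSelfAdjoint.of_nonneg hnn).star_eq] at h3
      refine h3.congr fun n => ?_
      rw [star_mul, he.star_eq, ← S.toSeqAlg_star, star_mul, ← S.ρ_star, hsa.star_eq]
    have h4 := h1.mul_const S.orderUnit
    have h5 := h2.const_mul S.orderUnit
    simp only [mul_assoc] at h4 h5
    have h6 : Commute S.orderUnit (S.toSeqAlg k y * S.toSeqAlg k y) := by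
      have := tendsto_nhds_unique h5 h4
      rw [Commute, SemiconjBy, this, mul_assoc]
    have h7 : CFC.sqrt (S.toSeqAlg k y * S.toSeqAlg k y) = S.toSeqAlg k y :=
      CFC.sqrt_mul_self _ hnn
    rw [← h7]
    exact (h6.symm.cfcₙ_nnreal _).symm
  obtain ⟨y, hy, -, hxy⟩ := CStarAlgebra.exists_sum_four_nonneg x
  rw [hxy, map_sum]
  refine Commute.sum_right _ _ _ fun i _ => ?_
  rw [map_smul]
  exact (key _ (hy i)).smul_right _

theorem le_norm_smul_orderUnit {z : SeqAlg F} (hz : z ∈ S.limit) (hsa : IsSelfAdjoint z) :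
    z ≤ ‖z‖ • S.orderUnit := by
  have key : ∀ k (x : F k), IsSelfAdjoint x →
      S.toSeqAlg k x ≤ ‖S.toSeqAlg k x‖ • S.orderUnit := by
    intro k x hx
    have h1 : ∀ c > ‖S.toSeqAlg k x‖, S.toSeqAlg k x ≤ c • S.orderUnit := by
      intro c hc
      rw [← sub_nonneg]
      have e1 : c • S.orderUnit - S.toSeqAlg k x = SeqAlg.mk ((c : ℂ) • S.orderUnitSeq - S.boundedSeq k x) := by
        rw [map_sub, map_smul, Complex.coe_smul]; rfl
      rw [e1]
      refine SeqAlg.mk_nonneg ?_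
      have h2 := SeqAlg.eventually_norm_lt (S.boundedSeq k x) hc
      obtain ⟨N, hN⟩ := eventually_atTop.1 h2
      filter_upwards [eventually_gt_atTop (max N k)] with m hm
      have hNk : N ≤ m - 1 ∧ k ≤ m - 1 := by omega
      have h3 : ‖S.ρ (m - 1) k x‖ < c := hN (m - 1) hNk.1
      have h4 : S.ρ (m - 1) k x ≤ (c : ℂ) • (1 : F (m - 1)) := by
        have h5 : IsSelfAdjoint (S.ρ (m - 1) k x) := by
          rw [IsSelfAdjoint, ← S.ρ_star, hx.star_eq]
        refine h5.le_algebraMap_norm_self.trans ?_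
        rw [Algebra.algebraMap_eq_smul_one, Complex.coe_smul]
        exact smul_le_smul_of_nonneg_right h3.le zero_le_one
      have h6 := S.ρ_mono m (m - 1) h4
      rw [map_smul, S.ρ_comp hNk.2 (Nat.sub_le _ _)] at h6
      exact sub_nonneg.2 h6
    have h2 : Tendsto (fun c : ℝ => c • S.orderUnit) (𝓝[>] ‖S.toSeqAlg k x‖)
        (𝓝 (‖S.toSeqAlg k x‖ • S.orderUnit)) :=
      (tendsto_nhdsWithin_of_tendsto_nhds tendsto_id).smul_const _
    refine ge_of_tendsto h2 ?_
    filter_upwards [self_mem_nhdsWithin] with c hc using h1 c hc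
  have key2 : realPart z ≤ ‖(realPart z : SeqAlg F)‖ • S.orderUnit := by
    refine S.limit_induction (P := fun z => realPart z ≤ ‖(realPart z : SeqAlg F)‖ • S.orderUnit)
      ?_ (fun k x => ?_) hz
    · refine isClosed_le ?_ ?_ <;> fun_prop
    · have e1 : (realPart (S.toSeqAlg k x) : SeqAlg F) = S.toSeqAlg k (realPart x : F k) := by
        rw [realPart_apply_coe, realPart_apply_coe, ← Complex.coe_smul, ← Complex.coe_smul,
          map_smul, map_add, S.toSeqAlg_star]
      rw [e1]
      exact key k _ (realPart x).2
  rwa [hsa.coe_realPart] at key2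

theorem norm_le_of_isSelfAdjoint {z : SeqAlg F} (hz : z ∈ S.limit) (hsa : IsSelfAdjoint z) :
    ‖z‖ ≤ ‖S.orderUnit * z‖ := by
  have hc := S.commute_orderUnit hz
  have h1 := S.le_norm_smul_orderUnit hz hsa
  have h2 := S.le_norm_smul_orderUnit (S.limit.neg_mem hz) hsa.neg
  rw [norm_neg, neg_le_iff_add_nonneg'] at h2
  rw [hc.eq]
  refine CStarAlgebra.norm_le_norm_mul_of_le (IsSelfAdjoint.of_nonneg S.orderUnit_nonneg) ?_
  have h0 : Commute (‖z‖ • S.orderUnit) z := hc.smul_left _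
  have h3 : Commute (‖z‖ • S.orderUnit - z) (z + ‖z‖ • S.orderUnit) :=
    (h0.sub_left (Commute.refl z)).add_right ((Commute.refl _).sub_left h0.symm)
  have h4 := Commute.mul_nonneg (sub_nonneg.2 h1) h2 h3
  rw [hsa.star_eq, ← sub_nonneg]
  convert h4 using 1
  rw [sub_mul, mul_add, mul_add, smul_mul_assoc, smul_mul_assoc, mul_smul_comm, mul_smul_comm,
    hc.eq, smul_smul, sq]
  abel

theorem exists_tendsto {u : ℕ → SeqAlg F} (hu : ∀ n, u n ∈ S.limit)
    (hnorm : ∀ m n, ‖u m - u n‖ ≤ ‖S.orderUnit * (u m - u n)‖) {w : SeqAlg F}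
    (hw : Tendsto (fun n => S.orderUnit * u n) atTop (𝓝 w)) :
    ∃ z ∈ S.limit, Tendsto u atTop (𝓝 z) ∧ S.orderUnit * z = w := by
  have hc : CauchySeq u := by
    rw [Metric.cauchySeq_iff]
    intro ε hε
    obtain ⟨N, hN⟩ := Metric.cauchySeq_iff.1 hw.cauchySeq ε hε
    refine ⟨N, fun m hm n hn => ?_⟩
    have h := hN m hm n hn
    rw [dist_eq_norm, ← mul_sub] at h
    rw [dist_eq_norm]
    exact (hnorm m n).trans_lt h
  obtain ⟨z, hz⟩ := cauchySeq_tendsto_of_complete hc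
  exact ⟨z, S.isClosed_limit.mem_of_tendsto hz (.of_forall hu), hz,
    tendsto_nhds_unique (hz.const_mul S.orderUnit) hw⟩

theorem norm_le {z : SeqAlg F} (hz : z ∈ S.limit) : ‖z‖ ≤ ‖S.orderUnit * z‖ := by
  refine S.limit_induction (P := fun z => ‖z‖ ≤ ‖S.orderUnit * z‖)
    (isClosed_le (by fun_prop) (by fun_prop)) (fun k x => ?_) hz
  have hsa : ∀ n, IsSelfAdjoint (S.toSeqAlg n (S.ρ n k (star x) * S.ρ n k x)) := by
    intro n
    rw [IsSelfAdjoint, ← S.toSeqAlg_star, star_mul, ← S.ρ_star, ← S.ρ_star, star_star]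
  obtain ⟨w, hw, hlim, hew⟩ := S.exists_tendsto
    (u := fun n => S.toSeqAlg n (S.ρ n k (star x) * S.ρ n k x))
    (fun n => S.toSeqAlg_mem_limit _ _)
    (fun m n => S.norm_le_of_isSelfAdjoint (S.limit.sub_mem (S.toSeqAlg_mem_limit _ _)
      (S.toSeqAlg_mem_limit _ _)) ((hsa m).sub (hsa n)))
    (S.tendsto_orderUnit_mul k (star x) x)
  have hwsa : IsSelfAdjoint w := tendsto_nhds_unique (hlim.star.congr fun n => (hsa n).star_eq) hlim
  have hwn : ‖w‖ ≤ ‖S.toSeqAlg k x‖ ^ 2 := by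
    refine (S.norm_le_of_isSelfAdjoint hw hwsa).trans_eq ?_
    rw [hew, S.toSeqAlg_star, CStarRing.norm_star_mul_self, sq]
  have h1 : w ≤ (‖S.toSeqAlg k x‖ ^ 2) • S.orderUnit :=
    (S.le_norm_smul_orderUnit hw hwsa).trans
      (smul_le_smul_of_nonneg_right hwn S.orderUnit_nonneg)
  have hcw := S.commute_orderUnit hw
  have h2 := Commute.mul_nonneg S.orderUnit_nonneg (sub_nonneg.2 h1)
    (((Commute.refl S.orderUnit).smul_right _).sub_right hcw)
  rw [mul_sub, sub_nonneg, hew, mul_smul_comm, S.toSeqAlg_star] at h2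
  rw [(S.commute_orderUnit (S.toSeqAlg_mem_limit k x)).eq]
  exact CStarAlgebra.norm_le_norm_mul_of_le (IsSelfAdjoint.of_nonneg S.orderUnit_nonneg) h2

theorem norm_orderUnit_mul {z : SeqAlg F} (hz : z ∈ S.limit) : ‖S.orderUnit * z‖ = ‖z‖ := by
  refine le_antisymm ((norm_mul_le _ _).trans ?_) (S.norm_le hz)
  exact mul_le_of_le_one_left (norm_nonneg _) S.norm_orderUnit_le

theorem eq_of_orderUnit_mul_eq {z w : SeqAlg F} (hz : z ∈ S.limit) (hw : w ∈ S.limit)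
    (h : S.orderUnit * z = S.orderUnit * w) : z = w := by
  have := S.norm_le (S.limit.sub_mem hz hw)
  rw [mul_sub, h, sub_self, norm_zero] at this
  exact sub_eq_zero.1 (norm_le_zero_iff.1 this)

theorem tendsto_orderUnit_mul_of_mem {x y : lp F ∞} (hx : SeqAlg.mk x ∈ S.limit)
    (hy : SeqAlg.mk y ∈ S.limit) :
    Tendsto (fun n => S.orderUnit * S.toSeqAlg n (x n * y n)) atTop
      (𝓝 (SeqAlg.mk x * SeqAlg.mk y)) := by
  have approx : ∀ ε > 0, ∃ k, ∃ a b : F k,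
      ‖SeqAlg.mk x * SeqAlg.mk y - S.toSeqAlg k a * S.toSeqAlg k b‖ < ε := by
    intro ε hε
    have hcont : Tendsto (fun p : SeqAlg F × SeqAlg F => p.1 * p.2)
        (𝓝 (SeqAlg.mk x, SeqAlg.mk y)) (𝓝 (SeqAlg.mk x * SeqAlg.mk y)) :=
      continuous_mul.tendsto (SeqAlg.mk x, SeqAlg.mk y)
    obtain ⟨δ, hδ, h⟩ := Metric.tendsto_nhds_nhds.1 hcont ε hε
    obtain ⟨i, a, ha⟩ := S.exists_norm_sub_lt hx hδ
    obtain ⟨j, b, hb⟩ := S.exists_norm_sub_lt hy hδ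
    refine ⟨max i j, S.ρ _ i a, S.ρ _ j b, ?_⟩
    rw [S.toSeqAlg_ρ (le_max_left i j), S.toSeqAlg_ρ (le_max_right i j), norm_sub_rev,
      ← dist_eq_norm]
    refine h (x := (S.toSeqAlg i a, S.toSeqAlg j b)) ?_
    rw [Prod.dist_eq, max_lt_iff, dist_comm, dist_eq_norm]
    refine ⟨ha, ?_⟩
    rwa [dist_comm, dist_eq_norm]
  rw [Metric.tendsto_atTop']
  intro ε hε
  obtain ⟨k, a, b, hab⟩ := approx (ε / 3) (by positivity)
  have h1 := SeqAlg.eventually_norm_lt (x * y - S.boundedSeq k a * S.boundedSeq k b) hab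
  have h2 := (Metric.tendsto_nhds.1 (S.tendsto_orderUnit_mul k a b)) (ε / 3) (by positivity)
  obtain ⟨N, hN⟩ := eventually_atTop.1 (h1.and h2)
  refine ⟨N, fun n hn => ?_⟩
  obtain ⟨h3, h4⟩ := hN n hn.le
  have h5 : ‖S.orderUnit * S.toSeqAlg n (x n * y n) -
      S.orderUnit * S.toSeqAlg n (S.ρ n k a * S.ρ n k b)‖ < ε / 3 := by
    rw [← mul_sub, S.norm_orderUnit_mul (S.limit.sub_mem (S.toSeqAlg_mem_limit _ _)
      (S.toSeqAlg_mem_limit _ _)), ← map_sub]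
    exact (S.norm_toSeqAlg_le _ _).trans_lt h3
  rw [dist_eq_norm] at h4 ⊢
  rw [norm_sub_rev] at hab
  calc ‖S.orderUnit * S.toSeqAlg n (x n * y n) - SeqAlg.mk x * SeqAlg.mk y‖
      = ‖(S.orderUnit * S.toSeqAlg n (x n * y n) -
          S.orderUnit * S.toSeqAlg n (S.ρ n k a * S.ρ n k b)) +
        (S.orderUnit * S.toSeqAlg n (S.ρ n k a * S.ρ n k b) -
          S.toSeqAlg k a * S.toSeqAlg k b) +
        (S.toSeqAlg k a * S.toSeqAlg k b - SeqAlg.mk x * SeqAlg.mk y)‖ := by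
        congr 1; abel
    _ < ε / 3 + ε / 3 + ε / 3 := (norm_add₃_le).trans_lt (by linarith)
    _ = ε := by ring

theorem exists_tendsto_mul {x y : lp F ∞} (hx : SeqAlg.mk x ∈ S.limit)
    (hy : SeqAlg.mk y ∈ S.limit) :
    ∃ z ∈ S.limit, Tendsto (fun n => S.toSeqAlg n (x n * y n)) atTop (𝓝 z) ∧
      S.orderUnit * z = SeqAlg.mk x * SeqAlg.mk y :=
  S.exists_tendsto (fun _ => S.toSeqAlg_mem_limit _ _)
    (fun _ _ => S.norm_le (S.limit.sub_mem (S.toSeqAlg_mem_limit _ _)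
      (S.toSeqAlg_mem_limit _ _)))
    (S.tendsto_orderUnit_mul_of_mem hx hy)

/-! ### The C⋆-algebra of a CPC*-system -/

/-- The product `x ∙ y = lim_n ρ_n(x_n y_n)`, where `x = [(x_n)]` and `y = [(y_n)]`. -/
def bulletMul (x y : SeqAlg F) : SeqAlg F :=
  limUnder atTop fun n => S.toSeqAlg n (SeqAlg.lift x n * SeqAlg.lift y n)

theorem bulletMul_spec {x y : SeqAlg F} (hx : x ∈ S.limit) (hy : y ∈ S.limit) :
    S.bulletMul x y ∈ S.limit ∧ S.orderUnit * S.bulletMul x y = x * y := by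
  obtain ⟨z, hz, hlim, hez⟩ := S.exists_tendsto_mul (x := SeqAlg.lift x) (y := SeqAlg.lift y)
    (by rwa [SeqAlg.mk_lift]) (by rwa [SeqAlg.mk_lift])
  have : S.bulletMul x y = z := hlim.limUnder_eq
  rw [this]
  refine ⟨hz, ?_⟩
  rw [hez, SeqAlg.mk_lift, SeqAlg.mk_lift]

/-- The product does not depend on the choice of the representing sequences. -/
theorem tendsto_bulletMul {x y : lp F ∞} (hx : SeqAlg.mk x ∈ S.limit)
    (hy : SeqAlg.mk y ∈ S.limit) :
    Tendsto (fun n => S.toSeqAlg n (x n * y n)) atTop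
      (𝓝 (S.bulletMul (SeqAlg.mk x) (SeqAlg.mk y))) := by
  obtain ⟨z, hz, hlim, hez⟩ := S.exists_tendsto_mul hx hy
  obtain ⟨h1, h2⟩ := S.bulletMul_spec hx hy
  rwa [S.eq_of_orderUnit_mul_eq h1 hz (h2.trans hez.symm)]

/-- The CPC*-limit of the system: the Banach space `S.limit ⊆ F_∞` with the norm and the
involution inherited from `F_∞`, and the product `∙`. -/
def CStarLimit : Type _ := S.limit

namespace CStarLimit

instance : NormedAddCommGroup S.CStarLimit := inferInstanceAs (NormedAddCommGroup S.limit)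

instance : NormedSpace ℂ S.CStarLimit := inferInstanceAs (NormedSpace ℂ S.limit)

instance : CompleteSpace S.CStarLimit :=
  S.isClosed_limit.completeSpace_coe

/-- The inclusion of the CPC*-limit, as a linear subspace, into `F_∞`. -/
def incl : S.CStarLimit →ₗ[ℂ] SeqAlg F := S.limit.subtype

instance : Mul S.CStarLimit :=
  ⟨fun x y => ⟨S.bulletMul (incl S x) (incl S y), (S.bulletMul_spec x.2 y.2).1⟩⟩

instance : Star S.CStarLimit := ⟨fun x => ⟨star (incl S x), S.star_mem_limit x.2⟩⟩

variable {S}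

theorem incl_mem (x : S.CStarLimit) : incl S x ∈ S.limit := x.2

theorem incl_injective : Function.Injective (incl S) := Subtype.val_injective

theorem norm_incl (x : S.CStarLimit) : ‖incl S x‖ = ‖x‖ := rfl

theorem incl_star (x : S.CStarLimit) : incl S (star x) = star (incl S x) := rfl

theorem orderUnit_mul_incl_mul (x y : S.CStarLimit) :
    S.orderUnit * incl S (x * y) = incl S x * incl S y :=
  (S.bulletMul_spec x.2 y.2).2

theorem ext_orderUnit {x y : S.CStarLimit}
    (h : S.orderUnit * incl S x = S.orderUnit * incl S y) : x = y :=
  incl_injective (S.eq_of_orderUnit_mul_eq (incl_mem x) (incl_mem y) h)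

theorem norm_mul_eq (x y : S.CStarLimit) : ‖x * y‖ = ‖incl S x * incl S y‖ := by
  rw [← norm_incl, ← S.norm_orderUnit_mul (incl_mem _), orderUnit_mul_incl_mul]

instance : NonUnitalRing S.CStarLimit where
  left_distrib x y z := ext_orderUnit (by
    simp only [map_add, mul_add, orderUnit_mul_incl_mul])
  right_distrib x y z := ext_orderUnit (by
    simp only [map_add, mul_add, add_mul, orderUnit_mul_incl_mul])
  zero_mul x := ext_orderUnit (by
    rw [orderUnit_mul_incl_mul, map_zero, zero_mul, mul_zero])
  mul_zero x := ext_orderUnit (by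
    rw [orderUnit_mul_incl_mul, map_zero, mul_zero, mul_zero])
  mul_assoc x y z := by
    have h : S.orderUnit * (S.orderUnit * (incl S (x * y * z) - incl S (x * (y * z)))) = 0 := by
      rw [mul_sub, mul_sub, orderUnit_mul_incl_mul, orderUnit_mul_incl_mul, ← mul_assoc,
        orderUnit_mul_incl_mul, ← mul_assoc, (S.commute_orderUnit (incl_mem x)).eq,
        mul_assoc (incl S x) S.orderUnit, orderUnit_mul_incl_mul, mul_assoc, sub_self]
    have h3 : S.orderUnit * (incl S (x * y * z) - incl S (x * (y * z))) = 0 := by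
      rw [← CStarRing.star_mul_self_eq_zero_iff, star_mul,
        (IsSelfAdjoint.of_nonneg S.orderUnit_nonneg).star_eq, mul_assoc, h, mul_zero]
    rw [mul_sub, sub_eq_zero] at h3
    exact ext_orderUnit h3

instance : NonUnitalNormedRing S.CStarLimit where
  dist_eq := NormedAddCommGroup.dist_eq
  norm_mul_le x y := by
    rw [norm_mul_eq]; exact norm_mul_le _ _

instance : StarRing S.CStarLimit where
  star_involutive x := incl_injective (by rw [incl_star, incl_star, star_star])
  star_add x y := incl_injective (by simp only [incl_star, map_add, star_add])
  star_mul x y := by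
    refine ext_orderUnit ?_
    have he := (IsSelfAdjoint.of_nonneg S.orderUnit_nonneg).star_eq
    rw [orderUnit_mul_incl_mul, incl_star, incl_star, incl_star, ← star_mul,
      ← orderUnit_mul_incl_mul, star_mul, he,
      (S.commute_orderUnit (S.star_mem_limit (incl_mem _))).eq]

instance : NonUnitalCStarAlgebra S.CStarLimit where
  norm_mul_self_le x := by
    rw [norm_mul_eq, incl_star, CStarRing.norm_star_mul_self, norm_incl]
  smul_assoc c x y := ext_orderUnit (by
    simp only [smul_eq_mul, orderUnit_mul_incl_mul, map_smul, mul_smul_comm, smul_mul_assoc])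
  smul_comm c x y := ext_orderUnit (by
    simp only [smul_eq_mul, orderUnit_mul_incl_mul, map_smul, mul_smul_comm])
  star_smul c x := incl_injective (by
    simp only [incl_star, map_smul, star_smul])

/-- The CPC*-limit carries the order of a C⋆-algebra. -/
instance : PartialOrder S.CStarLimit := CStarAlgebra.spectralOrder _

instance : StarOrderedRing S.CStarLimit := CStarAlgebra.spectralOrderedRing _

end CStarLimit

/-- The map `ρ_n`, as a map into the CPC*-limit. -/
def toCStarLimit (n : ℕ) : F n →ₗ[ℂ] S.CStarLimit :=
  (S.toSeqAlg n).codRestrict S.limit (S.toSeqAlg_mem_limit n)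

theorem incl_toCStarLimit (n : ℕ) (x : F n) :
    CStarLimit.incl S (S.toCStarLimit n x) = S.toSeqAlg n x := rfl

/-- The product of the CPC*-limit satisfies
`ρ_k(x) ∙ ρ_k(y) = lim_n ρ_n(ρ_{n,k}(x) ρ_{n,k}(y))`. -/
theorem tendsto_toCStarLimit_mul (k : ℕ) (x y : F k) :
    Tendsto (fun n => S.toCStarLimit n (S.ρ n k x * S.ρ n k y)) atTop
      (𝓝 (S.toCStarLimit k x * S.toCStarLimit k y)) :=
  tendsto_subtype_rng.2 (S.tendsto_bulletMul (x := S.boundedSeq k x) (y := S.boundedSeq k y)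
    (S.toSeqAlg_mem_limit k x) (S.toSeqAlg_mem_limit k y))

end CPCStarSystem

/-- An increasing approximate identity of a C⋆-algebra, indexed by `ℕ`: an increasing sequence of
positive contractions `u n` with `u n * a → a` and `a * u n → a` for all `a`. -/
structure IsIncreasingApproximateIdentity {A : Type*} [NonUnitalCStarAlgebra A] [PartialOrder A]
    [StarOrderedRing A] (u : ℕ → A) : Prop where
  nonneg : ∀ n, 0 ≤ u n
  norm_le_one : ∀ n, ‖u n‖ ≤ 1
  monotone : Monotone u
  tendsto_mul_left : ∀ a, Tendsto (fun n => u n * a) atTop (𝓝 a)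
  tendsto_mul_right : ∀ a, Tendsto (fun n => a * u n) atTop (𝓝 a)

end

/-! Write `e` for `S.orderUnit`. On the limit space, multiplication by `e` inside `F_∞` is
isometric, and `e` times the product `x ∙ y` is the ordinary product `x y` of `F_∞`. Norm estimates
for the new product therefore become norm estimates in `F_∞` (`norm_mul_sub`), where the defining
inequality of a CPC*-system can be read off entry by entry.

Order. The order of the limit is defined through the new product, so positivity in `F_∞` has to be
transferred to it (`nonneg_of_incl_nonneg`). Split a self-adjoint `z` as `z⁺ - z⁻` in the limit.
Both parts remain positive in `F_∞`, and they remain orthogonal there because their ordinary product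
is `e` times `z⁺ ∙ z⁻ = 0`. If `z` is positive in `F_∞`, then `z⁻ ≤ z⁺` there, and orthogonality
forces `z⁻ = 0`. So each `ρ_n` is positive into the limit, and `ρ_{n,k}(1) ≤ 1` yields `ρ_k(1) =
ρ_n(ρ_{n,k}(1)) ≤ ρ_n(1)`.

Convergence. The system condition with `l` held fixed, after the limits in `m` and then in `n`, says
that `ρ_l(1)` is almost a left unit for `ρ_k(x) ∙ ρ_k(y)` (`tendsto_toCStarLimit_one_mul_mul`).
Since the `ρ_l(1)` are contractions, the elements on which they act as a left approximate identity
form a closed subspace. It contains the squares from a dense set, hence all squares, hence all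
positive elements and their span, which is everything. Taking adjoints gives the right-hand version.
-/

/-! ### Closed subspaces and orthogonality in C⋆-algebras -/

/-- The elements on which a sequence of contractions acts as a left approximate identity form a
closed subspace. -/
def leftApproximatedSubmodule {A : Type*} [NonUnitalCStarAlgebra A] (u : ℕ → A) :
    Submodule ℂ A where
  carrier := {a | Tendsto (fun n => u n * a) atTop (𝓝 a)}
  zero_mem' := by simp
  add_mem' := by
    intro a b ha hb
    simpa only [Set.mem_ofPred_eq, mul_add] using Tendsto.add ha hb
  smul_mem' := by
    intro c a ha
    simpa only [Set.mem_ofPred_eq, mul_smul_comm] using Tendsto.const_smul ha c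

/-- Left multiplications by contractions are uniformly 1-Lipschitz, so pointwise convergence passes
to closures by an `ε / 3` argument. -/
theorem isClosed_leftApproximatedSubmodule {A : Type*} [NonUnitalCStarAlgebra A] {u : ℕ → A}
    (hu : ∀ n, ‖u n‖ ≤ 1) : IsClosed (leftApproximatedSubmodule u : Set A) := by
  refine isClosed_of_closure_subset fun a ha => Metric.tendsto_atTop.2 fun ε hε => ?_
  obtain ⟨b, hb, hab⟩ := Metric.mem_closure_iff.1 ha (ε / 3) (by positivity)
  obtain ⟨N, hN⟩ := Metric.tendsto_atTop.1 hb (ε / 3) (by positivity)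
  refine ⟨N, fun n hn => ?_⟩
  have h1 : dist (u n * a) (u n * b) ≤ dist a b := by
    rw [dist_eq_norm, dist_eq_norm, ← mul_sub]
    exact (norm_mul_le _ _).trans (mul_le_of_le_one_left (norm_nonneg _) (hu n))
  have h2 := dist_triangle4 (u n * a) (u n * b) b a
  have h3 := hN n hn
  rw [dist_comm b a] at h2
  linarith

/-- A closed subspace of a C⋆-algebra which contains all squares of positive elements is
everything. -/
theorem Submodule.eq_top_of_mul_self_mem {A : Type*} [NonUnitalCStarAlgebra A] [PartialOrder A]
    [StarOrderedRing A] (V : Submodule ℂ A) (h : ∀ s : A, 0 ≤ s → s * s ∈ V) (a : A) : a ∈ V := by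
  obtain ⟨y, hy, -, hay⟩ := CStarAlgebra.exists_sum_four_nonneg a
  rw [hay]
  refine V.sum_mem fun i _ => V.smul_mem _ ?_
  rw [← CFC.sqrt_mul_sqrt_self (y i) (hy i)]
  exact h _ (CFC.sqrt_nonneg _)

/-- If the difference of two orthogonal positive elements is positive, then the second one
vanishes. -/
theorem CStarAlgebra.eq_zero_of_le_of_mul_eq_zero {A : Type*} [NonUnitalCStarAlgebra A]
    [PartialOrder A] [StarOrderedRing A] {p q : A} (hq : 0 ≤ q) (hqp : q ≤ p) (h : p * q = 0) :
    q = 0 := by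
  have hsa := IsSelfAdjoint.of_nonneg hq
  -- Conjugating `q ≤ p` by `q` gives `q³ ≤ q p q = 0`.
  have h1 := star_left_conjugate_le_conjugate hqp q
  rw [hsa.star_eq, mul_assoc q p q, h, mul_zero] at h1
  have h2 := star_left_conjugate_nonneg hq q
  rw [hsa.star_eq] at h2
  have h3 : q * q * q = 0 := le_antisymm h1 h2
  -- From `q³ = 0` follows `q⁴ = 0`; two applications of the C⋆-identity give `q² = 0` and then `q =
  -- 0`.
  have h4 : star (q * q) * (q * q) = 0 := by
    rw [star_mul, hsa.star_eq, ← mul_assoc, h3, zero_mul]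
  have h5 := CStarRing.star_mul_self_eq_zero_iff _ |>.1 h4
  exact CStarRing.star_mul_self_eq_zero_iff _ |>.1 (by rw [hsa.star_eq, h5])

namespace CPCStarSystem

variable {F : ℕ → Type*} [∀ n, CStarAlgebra (F n)] [∀ n, PartialOrder (F n)]
  [∀ n, StarOrderedRing (F n)] [∀ n, FiniteDimensional ℂ (F n)] (S : CPCStarSystem F)

/-! ### Positivity in the limit compared with positivity in `F_∞` -/

namespace CStarLimit

variable {S}

/-- If `z = y⋆ ∙ y` and `(b_n)` represents `y`, then `z = lim ρ_n(b_n⋆ b_n)` is a norm limit of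
positive elements of `F_∞`, whose positive cone is closed. -/
theorem incl_nonneg {z : S.CStarLimit} (hz : 0 ≤ z) : 0 ≤ incl S z := by
  obtain ⟨y, rfl⟩ := CStarAlgebra.nonneg_iff_eq_star_mul_self.1 hz
  obtain ⟨b, hb⟩ := SeqAlg.mk_surjective (incl S y)
  have hb' : SeqAlg.mk (star b) = incl S (star y) := by rw [SeqAlg.mk_star, hb, incl_star]
  have h := S.tendsto_bulletMul (x := star b) (y := b) (by rw [hb']; exact incl_mem _)
    (by rw [hb]; exact incl_mem _)
  rw [hb', hb] at h
  exact ge_of_tendsto' h fun n => S.toSeqAlg_nonneg n (star_mul_self_nonneg (b n))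

/-- An element of the limit which is positive in the sequence algebra is positive for the
product of the limit. -/
theorem nonneg_of_incl_nonneg {z : S.CStarLimit} (hz : 0 ≤ incl S z) : 0 ≤ z := by
  have hsa : IsSelfAdjoint z :=
    incl_injective (by rw [incl_star, (IsSelfAdjoint.of_nonneg hz).star_eq])
  have hd := CFC.posPart_sub_negPart z hsa
  -- The positive and negative parts are formed with the product of the limit; they are compared as
  -- elements of `F_∞`.
  have h0 : incl S z⁻ = 0 := by
    refine CStarAlgebra.eq_zero_of_le_of_mul_eq_zero (p := incl S z⁺)
      (incl_nonneg (CFC.negPart_nonneg z)) ?_ ?_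
    · rwa [← sub_nonneg, ← map_sub, hd]
    -- Orthogonality survives the change of product: `z⁺ z⁻ = e (z⁺ ∙ z⁻) = 0` in `F_∞`.
    · rw [← orderUnit_mul_incl_mul, CFC.posPart_mul_negPart, map_zero, mul_zero]
  have h1 : z⁻ = 0 := incl_injective (by rw [h0, map_zero])
  rw [h1, sub_zero] at hd
  rw [← hd]
  exact CFC.posPart_nonneg z

/-- Holds because multiplication by `e` is isometric on the limit and carries `x ∙ y` to `x y`. It
trades the new product for the termwise one. -/
theorem norm_mul_sub (x y z : S.CStarLimit) :
    ‖x * y - z‖ = ‖incl S x * incl S y - S.orderUnit * incl S z‖ := by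
  rw [← norm_incl, ← S.norm_orderUnit_mul (incl_mem _), map_sub, mul_sub, orderUnit_mul_incl_mul]

end CStarLimit

/-! ### Positivity, contractivity and monotonicity of `ρ_n(1)` -/

theorem toCStarLimit_nonneg (n : ℕ) {x : F n} (hx : 0 ≤ x) : 0 ≤ S.toCStarLimit n x :=
  CStarLimit.nonneg_of_incl_nonneg (S.toSeqAlg_nonneg n hx)

theorem norm_toCStarLimit_one_le (n : ℕ) : ‖S.toCStarLimit n 1‖ ≤ 1 :=
  (S.norm_toSeqAlg_le n 1).trans (CStarAlgebra.norm_one_le_one _)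

theorem toCStarLimit_ρ {n k : ℕ} (hkn : k ≤ n) (x : F k) :
    S.toCStarLimit n (S.ρ n k x) = S.toCStarLimit k x :=
  CStarLimit.incl_injective (S.toSeqAlg_ρ hkn x)

theorem denseRange_toCStarLimit :
    DenseRange fun p : Σ k, F k => S.toCStarLimit p.1 p.2 := by
  refine fun z => Metric.mem_closure_iff.2 fun ε hε => ?_
  obtain ⟨k, x, hx⟩ := S.exists_norm_sub_lt (CStarLimit.incl_mem z) hε
  exact ⟨_, ⟨⟨k, x⟩, rfl⟩, by rw [dist_eq_norm]; exact hx⟩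

theorem ρ_one_le_one (m n : ℕ) : S.ρ m n 1 ≤ 1 :=
  CStarAlgebra.norm_le_one_iff_of_nonneg _ (S.ρ_nonneg m n zero_le_one) |>.1
    ((S.norm_ρ_le m n 1).trans (CStarAlgebra.norm_one_le_one _))

/-- The difference `ρ_n(1) - ρ_k(1)` is the image under `ρ_n` of `1 - ρ_{n,k}(1) ≥ 0`. -/
theorem monotone_toCStarLimit_one : Monotone fun n => S.toCStarLimit n 1 := by
  intro k n hkn
  have h := S.toCStarLimit_nonneg n (sub_nonneg.2 (S.ρ_one_le_one n k))
  rwa [map_sub, S.toCStarLimit_ρ hkn, sub_nonneg] at h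

/-! ### Convergence -/

/-- The system condition with `l` fixed, whereas `e` arises from the choice `l = m - 1`. The outer
factor `ρ_l(1)` is then an element of the limit itself. -/
theorem tendsto_toCStarLimit_one_mul_mul (k : ℕ) (x y : F k) :
    Tendsto (fun l => S.toCStarLimit l 1 * (S.toCStarLimit k x * S.toCStarLimit k y)) atTop
      (𝓝 (S.toCStarLimit k x * S.toCStarLimit k y)) := by
  rw [Metric.tendsto_atTop']
  intro ε hε
  obtain ⟨M, -, hM⟩ := S.asymptotically_order_zero k x y (ε / 2) (half_pos hε)
  refine ⟨M, fun l hl => ?_⟩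
  -- In `F_∞` the quantity to bound becomes `‖ρ_l(1) (ρ_k(x) ∙ ρ_k(y)) - ρ_k(x) ρ_k(y)‖`.
  rw [dist_eq_norm, CStarLimit.norm_mul_sub, CStarLimit.orderUnit_mul_incl_mul]
  -- Both limits below preserve only weak inequalities, hence the bound by `ε / 2`.
  refine lt_of_le_of_lt ?_ (half_lt_self hε)
  have hlim : Tendsto (fun n => S.toSeqAlg n (S.ρ n k x * S.ρ n k y)) atTop
      (𝓝 (CStarLimit.incl S (S.toCStarLimit k x * S.toCStarLimit k y))) :=
    tendsto_subtype_rng.1 (S.tendsto_toCStarLimit_mul k x y)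
  -- The inner product `ρ_k(x) ∙ ρ_k(y)` is replaced by its approximants `ρ_n(ρ_{n,k}(x)
  -- ρ_{n,k}(y))`, so a bound for all `n > M` suffices.
  refine le_of_tendsto ((hlim.const_mul (S.toSeqAlg l 1)).sub_const _).norm ?_
  filter_upwards [eventually_gt_atTop M] with n hn
  -- For `m > max l n`, the `m`-th entry of this representing sequence is exactly the expression in
  -- the system condition.
  refine SeqAlg.norm_mk_le_of_eventually (x := S.boundedSeq l 1 *
    S.boundedSeq n (S.ρ n k x * S.ρ n k y) - S.boundedSeq k x * S.boundedSeq k y)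
    (half_pos hε).le ?_
  filter_upwards [eventually_gt_atTop (max l n)] with m hm
  exact (hM m n l hn hl (by omega) (by omega)).le

theorem tendsto_toCStarLimit_one_mul (a : S.CStarLimit) :
    Tendsto (fun n => S.toCStarLimit n 1 * a) atTop (𝓝 a) := by
  let V := leftApproximatedSubmodule fun n => S.toCStarLimit n 1
  have hV : IsClosed (V : Set S.CStarLimit) :=
    isClosed_leftApproximatedSubmodule S.norm_toCStarLimit_one_le
  refine V.eq_top_of_mul_self_mem (fun s _ => ?_) a
  -- Squaring is continuous and `V` is closed, so it is enough to square elements of the dense union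
  -- of the `ρ_k(F_k)`.
  refine S.denseRange_toCStarLimit.induction_on (p := fun s => s * s ∈ V) s
    (hV.preimage (by fun_prop)) fun p => S.tendsto_toCStarLimit_one_mul_mul p.1 p.2 p.2

/-- The adjoint of the left-hand statement for `a⋆`, since each `ρ_n(1)` is self-adjoint. -/
theorem tendsto_mul_toCStarLimit_one (a : S.CStarLimit) :
    Tendsto (fun n => a * S.toCStarLimit n 1) atTop (𝓝 a) := by
  have h := (S.tendsto_toCStarLimit_one_mul (star a)).star
  rw [star_star] at h
  refine h.congr fun n => ?_
  rw [star_mul, star_star,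
    (IsSelfAdjoint.of_nonneg (S.toCStarLimit_nonneg n zero_le_one)).star_eq]

end CPCStarSystem

theorem mainTheorem8 {F : ℕ → Type*} [∀ n, CStarAlgebra (F n)] [∀ n, PartialOrder (F n)]
    [∀ n, StarOrderedRing (F n)] [∀ n, FiniteDimensional ℂ (F n)] (S : CPCStarSystem F) :
    IsIncreasingApproximateIdentity (fun n => S.toCStarLimit n 1) where
  nonneg n := S.toCStarLimit_nonneg n zero_le_one
  norm_le_one := S.norm_toCStarLimit_one_le
  monotone := S.monotone_toCStarLimit_one
  tendsto_mul_left := S.tendsto_toCStarLimit_one_mul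
  tendsto_mul_right := S.tendsto_mul_toCStarLimit_one
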